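/- Let $d\ge 2$ and let $\gamma,p,\nu,\kappa,r\in\mathbb R$, with $c=\gamma-d-1$, satisfy $$p>1,\quad r>1,\quad \tfrac1r=\tfrac2p+\tfrac{2\nu+\kappa}{d}-1,\quad \kappa<\tfrac dr,\quad \tfrac{d-1}{2}\bigl(1-\tfrac2p\bigr)<\nu<d\,\tfrac{p-1}{p},$$ $$2r\ge p,\quad \max\{\nu,\kappa\}>0,\quad \nu+\kappa\ge(d-1)\bigl(\tfrac1r-\tfrac1p\bigr),\quad p>\tfrac{r}{r-1},$$ $$\max\{0,d+p(c+\nu)\}<\tfrac{d(r-p)}{r}+p(\nu+\kappa+1)<\tfrac{\gamma p(r-1)}{r},\quad \tfrac{\gamma p(r-1)}{r}-\tfrac{d(r-p)}{r}-p(\nu+\kappa+1)>\gamma.$$ For measurable $f:\mathbb R^d\to\mathbb C^d$ put $\|f\|_{u_\nu,p}=\bigl(\int_{\mathbb R^d}|f(x)|^p u_\nu(x)^p\,dx\bigr)^{1/p}$ with $u_\nu(x)=e^{|x|}|x|^\nu$. Let $\mathfrak R^p_{u_\nu}$ be the set of radial $f$ (depending only on $|x|$, up to null sets) with $\|f\|_{u_\nu,p}<\infty$,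 and let $\mathfrak{RL}^p_{u_\nu}$ be the set of $f$ with $\|f\|_{u_\nu,p}<\infty$ for which there is $\widehat f\in\mathfrak R^p_{u_\nu}$ with $|f|\le|\widehat f|$ almost everywhere. Consider the Fourier-side generalized Navier--Stokes integral equation $$v(y,t)=e^{-|y|^\gamma t}v(y,0)-i\int_0^t\int_{\mathbb R^d}\bigl(y\cdot v(y-z,s)\bigr)\,P_yv(z,s)\,e^{-|y|^\gamma(t-s)}\,dz\,ds,\qquad y\cdot v(y,t)=0,$$ for $0\le t<T$ and almost every $y\in\mathbb R^d$, where $P_yw=w-\frac{w\cdot y}{|y|^2}y$ and the integral converges absolutely. Then there is a constant $D>0$, depending only on the parameters above, such that for every $T>0$ and every $\vartheta\in\mathfrak{RL}^p_{u_\nu}$ with $\|\vartheta\|_{u_\nu,p}<D$: if the Leray self-similar field $$v(y,t)=(T-t)^{\frac{d+1-\gamma}{\gamma}}\,\vartheta\bigl(y\,(T-t)^{\frac1\gamma}\bigr)$$ solves this equation, then $\vartheta=0$ almost everywhere. In particular, the same holds for every $\vartheta\in\mathfrak R^p_{u_\nu}$ with $\|\vartheta\|_{u_\nu,p}<D$.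 -/

import Mathlib

open MeasureTheory Set

noncomputable section

namespace LerayBlowup

/-- Physical frequency space `ℝ^d` with the Euclidean norm. -/
abbrev RSp (d : ℕ) := EuclideanSpace ℝ (Fin d)

/-- `ℂ^d` with the Hermitian norm, i.e. the Euclidean norm of `ℝ^{2d}`. -/
abbrev CSp (d : ℕ) := EuclideanSpace ℂ (Fin d)

/-- The inclusion `ℝ^d ⊂ ℂ^d`. -/
def toC {d : ℕ} (y : RSp d) : CSp d := WithLp.toLp 2 fun j => (y j : ℂ)

/-- The (bilinear) scalar product `y · v = ∑ y_j v_j` of `y ∈ ℝ^d` and `v ∈ ℂ^d`. -/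
def dot {d : ℕ} (y : RSp d) (v : CSp d) : ℂ := ∑ j, (y j : ℂ) * v j

/-- The Leray projection `P_y v = v - (v · y) / |y|² y`. -/
def lerayProj {d : ℕ} (y : RSp d) (v : CSp d) : CSp d :=
  v - (dot y v / ((‖y‖ ^ 2 : ℝ) : ℂ)) • toC y

/-- The integrand `(y · v(y - z, s)) P_y v(z, s) e^{-|y|^γ (t - s)}`. -/
def nonlinearity {d : ℕ} (γ : ℝ) (v : RSp d → ℝ → CSp d) (y : RSp d) (t s : ℝ) (z : RSp d) :
    CSp d :=
  Real.exp (-‖y‖ ^ γ * (t - s)) • (dot y (v (y - z) s) • lerayProj y (v z s))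

/-- `v` is transversal and solves the Fourier-side integral equation on `[0, T)`
with initial datum `v(·, 0)`:
`v(y,t) = e^{-|y|^γ t} v(y,0) - i ∫_0^t ∫ (y · v(y-z,s)) P_y v(z,s) e^{-|y|^γ (t-s)} dz ds`,
the double integral being absolutely convergent. As `v(·, t)` is a class of functions modulo
null sets, everything is required for almost every `y`. -/
def SolvesNS {d : ℕ} (γ T : ℝ) (v : RSp d → ℝ → CSp d) : Prop :=
  (∀ t ∈ Ico (0 : ℝ) T, ∀ᵐ y : RSp d, dot y (v y t) = 0) ∧
  ∀ t ∈ Ioo (0 : ℝ) T, ∀ᵐ y : RSp d,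
    IntegrableOn (fun q : ℝ × RSp d => nonlinearity γ v y t q.1 q.2) (Ioc 0 t ×ˢ univ) ∧
    v y t = Real.exp (-‖y‖ ^ γ * t) • v y 0
      - Complex.I • ∫ s in (0 : ℝ)..t, ∫ z : RSp d, nonlinearity γ v y t s z

/-- The Leray self-similar field with profile `ϑ` and blow-up time `T`:
`v(y,t) = (T - t)^{(d+1-γ)/γ} ϑ(y (T - t)^{1/γ})`. -/
def selfSimilar {d : ℕ} (γ T : ℝ) (ϑ : RSp d → CSp d) (y : RSp d) (t : ℝ) : CSp d :=
  ((T - t) ^ (((d : ℝ) + 1 - γ) / γ)) • ϑ (((T - t) ^ (1 / γ)) • y)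

/-- The weight `u_ν(x) = e^{|x|} |x|^ν`. -/
def weight {d : ℕ} (ν : ℝ) (x : RSp d) : ℝ := Real.exp ‖x‖ * ‖x‖ ^ ν

/-- The weighted norm `(∫ |f|^p u_ν^p)^{1/p}`, with values in `[0, ∞]`. -/
def wNorm {d : ℕ} (p ν : ℝ) (f : RSp d → CSp d) : ENNReal :=
  eLpNorm (fun x => weight ν x • f x) (ENNReal.ofReal p) volume

/-- Measurable complex vector fields of finite weighted norm. -/
def MemWeighted {d : ℕ} (p ν : ℝ) (f : RSp d → CSp d) : Prop :=
  MemLp (fun x => weight ν x • f x) (ENNReal.ofReal p) volume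

/-- Vector fields depending on `|x|` only. -/
def IsRadial {d : ℕ} (f : RSp d → CSp d) : Prop := ∀ x y, ‖x‖ = ‖y‖ → f x = f y

/-- Radial elements of the weighted space (radial up to a null set). -/
def MemRadial {d : ℕ} (p ν : ℝ) (f : RSp d → CSp d) : Prop :=
  MemWeighted p ν f ∧ ∃ g : RSp d → CSp d, IsRadial g ∧ f =ᵐ[volume] g

/-- Radially dominated elements of the weighted space: `|f| ≤ |f̂|` for some radial element `f̂`
of the weighted space. -/
def MemRadiallyDominated {d : ℕ} (p ν : ℝ) (f : RSp d → CSp d) : Prop :=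
  MemWeighted p ν f ∧
    ∃ fhat : RSp d → CSp d, MemRadial p ν fhat ∧ ∀ᵐ x : RSp d, ‖f x‖ ≤ ‖fhat x‖

/-- The conditions on the exponents. -/
structure Admissible (d : ℕ) (γ p ν κ r : ℝ) : Prop where
  one_lt_p : 1 < p
  one_lt_r : 1 < r
  scaling : 1 / r = 2 / p + (2 * ν + κ) / d - 1
  kappa_lt : κ < d / r
  lt_nu : ((d : ℝ) - 1) / 2 * (1 - 2 / p) < ν
  nu_lt : ν < d * ((p - 1) / p)
  p_le : p ≤ 2 * r
  max_pos : 0 < max ν κ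
  nu_add_kappa : ((d : ℝ) - 1) * (1 / r - 1 / p) ≤ ν + κ
  lower : max 0 (d + p * ((γ - d - 1) + ν)) < d * (r - p) / r + p * (ν + κ + 1)
  upper : d * (r - p) / r + p * (ν + κ + 1) < γ * p * (r - 1) / r
  gap : γ < γ * p * (r - 1) / r - d * (r - p) / r - p * (ν + κ + 1)
  p_gt : r / (r - 1) < p

end LerayBlowup

end

/-!
Every solution is controlled in `L¹` by a quadratic inequality: since `|y| e^{-|y|^γ τ} ≤ τ^{-1/γ}`
and the `L¹` norm of a convolution is the product of the `L¹` norms,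
`‖v(t)‖₁ ≤ ‖v(0)‖₁ + ∫₀ᵗ (t - s)^{-1/γ} ‖v(s)‖₁² ds`, where the kernel is integrable because the
conditions on the exponents force `γ > 1`. A self-similar field has
`‖v(t)‖₁ = (T - t)^{-(1 - 1/γ)} ‖ϑ‖₁`, an increasing function of `t`. At the time when it has
doubled, the inequality reads `2A ≤ A + C (2A)²` with `A = ‖v(0)‖₁`, so `A = 0` as soon as
`4 C A < 1`. Since `C` scales like `T^{1 - 1/γ}`, the product `C A` is bounded by a multiple of
`‖ϑ‖₁` that does not depend on `T`.
Finally, `ν < d (p - 1) / p` says exactly that `1 / u_ν` lies in the dual space `L^{p'}`, so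
Hölder's inequality bounds `‖ϑ‖₁` by the weighted norm.
-/

namespace LerayBlowup

open Module Real
open scoped ENNReal

section Lintegral

variable {G : Type*} [MeasurableSpace G] [AddGroup G] [MeasurableAdd₂ G] [MeasurableNeg G]
  {μ : Measure G} [SFinite μ] [μ.IsAddLeftInvariant]

lemma lintegral_lconvolution {f g : G → ℝ≥0∞} (hf : AEMeasurable f μ) (hg : AEMeasurable g μ) :
    ∫⁻ x, (f ⋆ₗ[μ] g) x ∂μ = (∫⁻ x, f x ∂μ) * ∫⁻ x, g x ∂μ := by
  simp only [lconvolution_def]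
  rw [lintegral_lintegral_swap (by fun_prop), ← lintegral_mul_const'' _ hf]
  congr with y
  have hgy : AEMeasurable (fun x => g (-y + x)) μ :=
    hg.comp_quasiMeasurePreserving (measurePreserving_add_left μ (-y)).quasiMeasurePreserving
  rw [lintegral_const_mul'' _ hgy, lintegral_add_left_eq_self g (-y)]

lemma aemeasurable_uncurry_lconvolution {S : Type*} [MeasurableSpace S] {τ : Measure S} [SFinite τ]
    {f g : S → G → ℝ≥0∞} (hf : AEMeasurable (Function.uncurry f) (τ.prod μ))
    (hg : AEMeasurable (Function.uncurry g) (τ.prod μ)) :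
    AEMeasurable (Function.uncurry fun s => f s ⋆ₗ[μ] g s) (τ.prod μ) := by
  have hproj : Measure.QuasiMeasurePreserving (fun q : (S × G) × G => (q.1.1, q.2))
      ((τ.prod μ).prod μ) (τ.prod μ) :=
    QuasiMeasurePreserving.prodMap Measure.quasiMeasurePreserving_fst (.id μ)
  have hshear : Measure.QuasiMeasurePreserving (fun q : (S × G) × G => (q.1.1, -q.2 + q.1.2))
      ((τ.prod μ).prod μ) (τ.prod μ) :=
    QuasiMeasurePreserving.prod_of_left (by fun_prop) <| .of_forall fun y =>
      QuasiMeasurePreserving.prodMap (.id τ)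
        (measurePreserving_add_left μ (-y)).quasiMeasurePreserving
  exact ((hf.comp_quasiMeasurePreserving hproj).mul
    (hg.comp_quasiMeasurePreserving hshear)).lintegral_prod_right'

lemma lintegral_lintegral_mul_lconvolution {S : Type*} [MeasurableSpace S] {τ : Measure S}
    [SFinite τ] {k : S → ℝ≥0∞} (hk : AEMeasurable k τ) {f g : S → G → ℝ≥0∞}
    (hf : AEMeasurable (Function.uncurry f) (τ.prod μ))
    (hg : AEMeasurable (Function.uncurry g) (τ.prod μ)) :
    ∫⁻ x, ∫⁻ s, k s * (f s ⋆ₗ[μ] g s) x ∂τ ∂μ =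
      ∫⁻ s, k s * ((∫⁻ x, f s x ∂μ) * ∫⁻ x, g s x ∂μ) ∂τ := by
  rw [← lintegral_lintegral_swap (hk.comp_fst.mul (aemeasurable_uncurry_lconvolution hf hg))]
  refine lintegral_congr_ae ?_
  filter_upwards [hf.aestronglyMeasurable.prodMk_left, hg.aestronglyMeasurable.prodMk_left]
    with s hfs hgs
  have hfs : AEMeasurable (f s) μ := hfs.aemeasurable
  have hgs : AEMeasurable (g s) μ := hgs.aemeasurable
  rw [← lintegral_lconvolution hfs hgs]
  exact lintegral_const_mul'' _ (aemeasurable_lconvolution hfs hgs)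

end Lintegral

lemma lintegral_comp_smul {E : Type*} [NormedAddCommGroup E] [NormedSpace ℝ E]
    [FiniteDimensional ℝ E] [MeasurableSpace E] [BorelSpace E] (μ : Measure E) [μ.IsAddHaarMeasure]
    (f : E → ℝ≥0∞) {c : ℝ} (hc : c ≠ 0) :
    ∫⁻ x, f (c • x) ∂μ = ENNReal.ofReal |(c ^ finrank ℝ E)⁻¹| * ∫⁻ x, f x ∂μ := by
  rw [← (measurableEmbedding_const_smul₀ hc).lintegral_map, Measure.map_addHaar_smul μ hc,
    lintegral_smul_measure, smul_eq_mul]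

lemma lintegral_Ioo_sub_rpow {t a : ℝ} (ht : 0 < t) (ha : -1 < a) :
    ∫⁻ s in Ioo 0 t, ENNReal.ofReal ((t - s) ^ a) = ENNReal.ofReal (t ^ (a + 1) / (a + 1)) := by
  have hint : IntegrableOn (fun s => (t - s) ^ a) (Ioo 0 t) := by
    rw [← intervalIntegrable_iff_integrableOn_Ioo_of_le ht.le]
    simpa using (intervalIntegral.intervalIntegrable_rpow' (a := t) (b := 0) ha).comp_sub_left t
  have hnonneg : 0 ≤ᵐ[volume.restrict (Ioo 0 t)] fun s => (t - s) ^ a := by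
    filter_upwards [ae_restrict_mem measurableSet_Ioo] with s hs
    exact rpow_nonneg (sub_pos.2 hs.2).le _
  rw [← ofReal_integral_eq_lintegral_ofReal hint hnonneg, ← integral_Ioc_eq_integral_Ioo,
    ← intervalIntegral.integral_of_le ht.le,
    intervalIntegral.integral_comp_sub_left (fun x => x ^ a) t, integral_rpow (.inl ha)]
  simp [show a + 1 ≠ 0 by linarith]

lemma eq_zero_of_two_mul_le_add_mul_sq {A C : ℝ≥0∞} (hA : A ≠ ∞) (hCA : 4 * C * A < 1)
    (h : 2 * A ≤ A + C * (2 * A) ^ 2) : A = 0 := by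
  have hle : A ≤ 4 * C * A * A := by
    rw [two_mul A] at h
    convert ENNReal.le_of_add_le_add_left hA h using 1
    ring
  by_contra hne
  exact hle.not_gt (by simpa using ENNReal.mul_lt_mul_left hne hA hCA)

lemma four_mul_ofReal_mul_lt_one {a b β : ℝ} (hβ : 0 < β) (ha : 0 ≤ a) (hab : a * b ≤ 1 / β)
    {N : ℝ≥0∞} (hN : N < ENNReal.ofReal (β / 4)) :
    4 * ENNReal.ofReal a * (ENNReal.ofReal b * N) < 1 :=
  calc 4 * ENNReal.ofReal a * (ENNReal.ofReal b * N) = 4 * ENNReal.ofReal (a * b) * N := by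
        rw [ENNReal.ofReal_mul ha]
        ring
    _ ≤ 4 * ENNReal.ofReal (1 / β) * N := by gcongr
    _ < 4 * ENNReal.ofReal (1 / β) * ENNReal.ofReal (β / 4) := by
        gcongr
        all_goals simp [hβ, ENNReal.mul_eq_top]
    _ = 1 := by
        rw [← ENNReal.ofReal_ofNat 4, ← ENNReal.ofReal_mul four_pos.le,
          ← ENNReal.ofReal_mul (by positivity), ← ENNReal.ofReal_one]
        congr 1
        field_simp

lemma rpow_div_mul_rpow_neg_le {t T β : ℝ} (ht : 0 ≤ t) (htT : t ≤ T) (hβ : 0 < β) :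
    t ^ β / β * T ^ (-β) ≤ 1 / β := by
  have hT : 0 ≤ T := ht.trans htT
  rw [div_mul_eq_mul_div, rpow_neg hT, ← div_eq_mul_inv]
  gcongr
  exact div_le_one_of_le₀ (rpow_le_rpow ht htT hβ.le) (rpow_nonneg hT _)

lemma exists_mem_Ioo_sub_rpow_neg_eq_two_mul {T β : ℝ} (hT : 0 < T) (hβ : 0 < β) :
    ∃ t ∈ Ioo 0 T, (T - t) ^ (-β) = 2 * T ^ (-β) := by
  set a : ℝ := 2 ^ (-β⁻¹)
  have ha : 0 < a := by positivity
  have ha1 : a < 1 := rpow_lt_one_of_one_lt_of_neg one_lt_two (by simpa)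
  refine ⟨T * (1 - a), ⟨mul_pos hT (sub_pos.2 ha1), by nlinarith⟩, ?_⟩
  rw [show T - T * (1 - a) = a * T by ring, mul_rpow ha.le hT.le, ← rpow_mul zero_le_two]
  simp [hβ.ne']

lemma le_exp_rpow {γ x : ℝ} (hγ : 1 ≤ γ) (hx : 0 ≤ x) : x ≤ exp (x ^ γ) := by
  have h : x ≤ x ^ γ + 1 := by
    rcases le_total x 1 with h1 | h1
    · linarith [rpow_nonneg hx γ]
    · linarith [self_le_rpow_of_one_le h1 hγ]
  exact h.trans (add_one_le_exp _)

lemma mul_exp_neg_rpow_mul_le {γ a b : ℝ} (hγ : 1 ≤ γ) (ha : 0 ≤ a) (hb : 0 < b) :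
    a * exp (-a ^ γ * b) ≤ b ^ (-(1 / γ)) := by
  have hpow : (b ^ (1 / γ) * a) ^ γ = a ^ γ * b := by
    rw [mul_rpow (by positivity) ha, ← rpow_mul hb.le, one_div_mul_cancel (by linarith), rpow_one,
      mul_comm]
  have hle := le_exp_rpow hγ (x := b ^ (1 / γ) * a) (by positivity)
  rw [hpow] at hle
  rw [neg_mul, exp_neg, rpow_neg hb.le, ← div_eq_mul_inv, div_le_iff₀ (exp_pos _),
    le_inv_mul_iff₀ (rpow_pos_of_pos hb _)]
  exact hle

variable {d : ℕ}

lemma norm_toC (y : RSp d) : ‖toC y‖ = ‖y‖ := by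
  simp [toC, EuclideanSpace.norm_eq]

lemma dot_eq_inner_toC (y : RSp d) (w : CSp d) : dot y w = inner ℂ (toC y) w := by
  simp [dot, toC, PiLp.inner_apply, mul_comm]

lemma norm_dot_le (y : RSp d) (w : CSp d) : ‖dot y w‖ ≤ ‖y‖ * ‖w‖ := by
  rw [dot_eq_inner_toC, ← norm_toC y]
  exact norm_inner_le_norm _ _

lemma lerayProj_eq_starProjection (y : RSp d) (w : CSp d) :
    lerayProj y w = (ℂ ∙ toC y)ᗮ.starProjection w := by
  rw [Submodule.starProjection_orthogonal_val, Submodule.starProjection_singleton, lerayProj,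
    dot_eq_inner_toC, norm_toC]
  rfl

lemma norm_lerayProj_le (y : RSp d) (w : CSp d) : ‖lerayProj y w‖ ≤ ‖w‖ := by
  rw [lerayProj_eq_starProjection]
  exact Submodule.norm_starProjection_apply_le _ w

lemma norm_nonlinearity_le {γ t s : ℝ} (hγ : 1 ≤ γ) (hst : s < t) (v : RSp d → ℝ → CSp d)
    (y z : RSp d) :
    ‖nonlinearity γ v y t s z‖ ≤ (t - s) ^ (-(1 / γ)) * (‖v z s‖ * ‖v (y - z) s‖) :=
  calc ‖nonlinearity γ v y t s z‖
      = exp (-‖y‖ ^ γ * (t - s)) * (‖dot y (v (y - z) s)‖ * ‖lerayProj y (v z s)‖) := by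
        rw [nonlinearity, norm_smul, norm_smul, norm_of_nonneg (exp_nonneg _)]
    _ ≤ exp (-‖y‖ ^ γ * (t - s)) * ((‖y‖ * ‖v (y - z) s‖) * ‖v z s‖) := by
        gcongr
        · exact norm_dot_le _ _
        · exact norm_lerayProj_le _ _
    _ = ‖y‖ * exp (-‖y‖ ^ γ * (t - s)) * (‖v z s‖ * ‖v (y - z) s‖) := by ring
    _ ≤ (t - s) ^ (-(1 / γ)) * (‖v z s‖ * ‖v (y - z) s‖) := by
        gcongr
        exact mul_exp_neg_rpow_mul_le hγ (norm_nonneg _) (sub_pos.2 hst)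

lemma lintegral_enorm_nonlinearity_le {γ t s : ℝ} (hγ : 1 ≤ γ) (hst : s < t)
    (v : RSp d → ℝ → CSp d) (y : RSp d) :
    ∫⁻ z, ‖nonlinearity γ v y t s z‖ₑ ≤
      ENNReal.ofReal ((t - s) ^ (-(1 / γ))) * ((fun x => ‖v x s‖ₑ) ⋆ₗ fun x => ‖v x s‖ₑ) y := by
  rw [lconvolution_def, ← lintegral_const_mul' _ _ ENNReal.ofReal_ne_top]
  refine lintegral_mono fun z => ?_
  have hts : 0 ≤ (t - s) ^ (-(1 / γ)) := rpow_nonneg (sub_pos.2 hst).le _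
  rw [neg_add_eq_sub, ← ofReal_norm, ← ofReal_norm, ← ofReal_norm,
    ← ENNReal.ofReal_mul (norm_nonneg _), ← ENNReal.ofReal_mul hts]
  exact ENNReal.ofReal_le_ofReal (norm_nonlinearity_le hγ hst v y z)

lemma SolvesNS.ae_enorm_le {γ T t : ℝ} {v : RSp d → ℝ → CSp d} (h : SolvesNS γ T v) (hγ : 1 ≤ γ)
    (ht : t ∈ Ioo 0 T) :
    ∀ᵐ y, ‖v y t‖ₑ ≤ ‖v y 0‖ₑ + ∫⁻ s in Ioo 0 t, ENNReal.ofReal ((t - s) ^ (-(1 / γ))) *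
      ((fun x => ‖v x s‖ₑ) ⋆ₗ fun x => ‖v x s‖ₑ) y := by
  filter_upwards [h.2 t ht] with y hy
  have hlin : ‖exp (-‖y‖ ^ γ * t) • v y 0‖ₑ ≤ ‖v y 0‖ₑ := by
    have hexp : exp (-‖y‖ ^ γ * t) ≤ 1 := by
      rw [exp_le_one_iff, neg_mul, neg_nonpos]
      exact mul_nonneg (by positivity) ht.1.le
    rw [enorm_smul, enorm_of_nonneg (exp_nonneg _)]
    exact mul_le_of_le_one_left' (ENNReal.ofReal_le_one.2 hexp)
  have hduhamel : ‖Complex.I • ∫ s in (0 : ℝ)..t, ∫ z, nonlinearity γ v y t s z‖ₑ ≤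
      ∫⁻ s in Ioo 0 t, ∫⁻ z, ‖nonlinearity γ v y t s z‖ₑ := by
    rw [enorm_smul, ← ofReal_norm Complex.I, Complex.norm_I, ENNReal.ofReal_one, one_mul,
      intervalIntegral.integral_of_le ht.1.le, integral_Ioc_eq_integral_Ioo]
    exact (enorm_integral_le_lintegral_enorm _).trans
      (lintegral_mono fun s => enorm_integral_le_lintegral_enorm _)
  calc ‖v y t‖ₑ ≤ ‖exp (-‖y‖ ^ γ * t) • v y 0‖ₑ +
        ‖Complex.I • ∫ s in (0 : ℝ)..t, ∫ z, nonlinearity γ v y t s z‖ₑ := by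
        rw [hy.2]
        exact enorm_sub_le
    _ ≤ _ := add_le_add hlin <| hduhamel.trans <| setLIntegral_mono' measurableSet_Ioo
        fun s hs => lintegral_enorm_nonlinearity_le hγ hs.2 v y

lemma SolvesNS.lintegral_enorm_le {γ T t : ℝ} {v : RSp d → ℝ → CSp d} (h : SolvesNS γ T v)
    (hγ : 1 < γ) (ht : t ∈ Ioo 0 T) (hv₀ : AEMeasurable fun y => ‖v y 0‖ₑ)
    (hv : AEMeasurable (fun q : ℝ × RSp d => ‖v q.2 q.1‖ₑ)
      ((volume.restrict (Ioo 0 t)).prod volume))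
    {M : ℝ≥0∞} (hM : ∀ s ∈ Ioo 0 t, ∫⁻ y, ‖v y s‖ₑ ≤ M) :
    ∫⁻ y, ‖v y t‖ₑ ≤
      (∫⁻ y, ‖v y 0‖ₑ) + ENNReal.ofReal (t ^ (1 - 1 / γ) / (1 - 1 / γ)) * M ^ 2 := by
  have hexp : -1 < -(1 / γ) := neg_lt_neg ((div_lt_one (one_pos.trans hγ)).2 hγ)
  have hk : Measurable fun s => ENNReal.ofReal ((t - s) ^ (-(1 / γ))) := by fun_prop
  refine (lintegral_mono_ae (h.ae_enorm_le hγ.le ht)).trans ?_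
  rw [lintegral_add_left' hv₀, lintegral_lintegral_mul_lconvolution hk.aemeasurable hv hv]
  gcongr
  calc ∫⁻ s in Ioo 0 t, ENNReal.ofReal ((t - s) ^ (-(1 / γ))) *
        ((∫⁻ y, ‖v y s‖ₑ) * ∫⁻ y, ‖v y s‖ₑ)
      ≤ ∫⁻ s in Ioo 0 t, ENNReal.ofReal ((t - s) ^ (-(1 / γ))) * M ^ 2 :=
        setLIntegral_mono' measurableSet_Ioo fun s hs => by
          rw [sq]
          gcongr <;> exact hM s hs
    _ = ENNReal.ofReal (t ^ (1 - 1 / γ) / (1 - 1 / γ)) * M ^ 2 := by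
        rw [lintegral_mul_const _ hk, lintegral_Ioo_sub_rpow ht.1 hexp, neg_add_eq_sub]

lemma lintegral_enorm_selfSimilar {γ T t : ℝ} (hγ : γ ≠ 0) (ht : t < T) (ϑ : RSp d → CSp d) :
    ∫⁻ y, ‖selfSimilar γ T ϑ y t‖ₑ =
      ENNReal.ofReal ((T - t) ^ (-(1 - 1 / γ))) * ∫⁻ y, ‖ϑ y‖ₑ := by
  have h0 : 0 < T - t := sub_pos.2 ht
  have hscale : 0 < (T - t) ^ (1 / γ) := rpow_pos_of_pos h0 _
  simp only [selfSimilar, enorm_smul]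
  rw [lintegral_const_mul' _ _ enorm_ne_top, lintegral_comp_smul volume (‖ϑ ·‖ₑ) hscale.ne',
    ← mul_assoc, enorm_of_nonneg (rpow_nonneg h0.le _), ← ENNReal.ofReal_mul (by positivity),
    finrank_euclideanSpace_fin, abs_of_pos (by positivity), ← rpow_natCast, ← rpow_mul h0.le,
    ← rpow_neg h0.le, ← rpow_add h0]
  congr 3
  field_simp
  ring

lemma quasiMeasurePreserving_selfSimilar_scale {γ T t : ℝ} (ht : t < T) :
    Measure.QuasiMeasurePreserving (fun y : RSp d => (T - t) ^ (1 / γ) • y) :=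
  Measure.quasiMeasurePreserving_smul volume (rpow_pos_of_pos (sub_pos.2 ht) _).ne'

lemma aemeasurable_selfSimilar {γ T t : ℝ} (ht : t < T) {ϑ : RSp d → CSp d}
    (hϑ : AEMeasurable ϑ) : AEMeasurable fun y => selfSimilar γ T ϑ y t :=
  (hϑ.comp_quasiMeasurePreserving (quasiMeasurePreserving_selfSimilar_scale ht)).const_smul
    ((T - t) ^ (((d : ℝ) + 1 - γ) / γ))

lemma aemeasurable_prod_selfSimilar {γ T : ℝ} {ϑ : RSp d → CSp d} (hϑ : AEMeasurable ϑ) :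
    AEMeasurable (fun q : ℝ × RSp d => selfSimilar γ T ϑ q.2 q.1)
      ((volume.restrict (Iio T)).prod volume) := by
  have hscale : Measure.QuasiMeasurePreserving (fun q : ℝ × RSp d => (T - q.1) ^ (1 / γ) • q.2)
      ((volume.restrict (Iio T)).prod volume) volume := by
    refine QuasiMeasurePreserving.prod_of_right (by fun_prop) ?_
    filter_upwards [ae_restrict_mem measurableSet_Iio] with s hs
    exact quasiMeasurePreserving_selfSimilar_scale hs
  have hcoeff : Measurable fun q : ℝ × RSp d => (T - q.1) ^ (((d : ℝ) + 1 - γ) / γ) := by fun_prop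
  exact hcoeff.aemeasurable.smul (hϑ.comp_quasiMeasurePreserving hscale)

theorem SolvesNS.ae_eq_zero_of_lintegral_enorm_lt {γ T : ℝ} {ϑ : RSp d → CSp d}
    (h : SolvesNS γ T (selfSimilar γ T ϑ)) (hγ : 1 < γ) (hT : 0 < T) (hϑ : AEMeasurable ϑ)
    (hsmall : ∫⁻ y, ‖ϑ y‖ₑ < ENNReal.ofReal ((1 - 1 / γ) / 4)) : ϑ =ᵐ[volume] 0 := by
  have hγ0 : 0 < γ := one_pos.trans hγ
  have hβ : 0 < 1 - 1 / γ := sub_pos.2 ((div_lt_one hγ0).2 hγ)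
  have hnorm {s : ℝ} (hs : s < T) := lintegral_enorm_selfSimilar hγ0.ne' hs ϑ
  obtain ⟨t, ht, htwo⟩ := exists_mem_Ioo_sub_rpow_neg_eq_two_mul hT hβ
  set β := 1 - 1 / γ
  set A := ENNReal.ofReal (T ^ (-β)) * ∫⁻ y, ‖ϑ y‖ₑ
  have hA_top : A ≠ ∞ := ENNReal.mul_ne_top ENNReal.ofReal_ne_top hsmall.ne_top
  have hinit : ∫⁻ y, ‖selfSimilar γ T ϑ y 0‖ₑ = A := by rw [hnorm hT, sub_zero]
  have hfinal : ∫⁻ y, ‖selfSimilar γ T ϑ y t‖ₑ = 2 * A := by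
    rw [hnorm ht.2, htwo, ENNReal.ofReal_mul zero_le_two, ENNReal.ofReal_ofNat, mul_assoc]
  have hmono : ∀ s ∈ Ioo 0 t, ∫⁻ y, ‖selfSimilar γ T ϑ y s‖ₑ ≤ 2 * A := fun s hs => by
    rw [← hfinal, hnorm (hs.2.trans ht.2), hnorm ht.2]
    gcongr ENNReal.ofReal ?_ * _
    exact rpow_le_rpow_of_nonpos (sub_pos.2 ht.2) (by linarith [hs.2]) (by linarith)
  have hsub : Ioo 0 t ⊆ Iio T := fun s hs => hs.2.trans ht.2
  have hquad := h.lintegral_enorm_le hγ ht (aemeasurable_selfSimilar hT hϑ).enorm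
    ((aemeasurable_prod_selfSimilar hϑ).enorm.mono_measure
      (Measure.prod_mono (Measure.restrict_mono hsub le_rfl) le_rfl)) hmono
  rw [hinit, hfinal] at hquad
  have hcontract : 4 * ENNReal.ofReal (t ^ β / β) * A < 1 :=
    four_mul_ofReal_mul_lt_one hβ (div_nonneg (rpow_nonneg ht.1.le _) hβ.le)
      (rpow_div_mul_rpow_neg_le ht.1.le ht.2.le hβ) hsmall
  have hzero : A = 0 := eq_zero_of_two_mul_le_add_mul_sq hA_top hcontract hquad
  have hint : ∫⁻ y, ‖ϑ y‖ₑ = 0 := by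
    simpa [A, (rpow_pos_of_pos hT _).not_ge] using hzero
  filter_upwards [(lintegral_eq_zero_iff' hϑ.enorm).1 hint] with y hy
  simpa using hy

section Weight

lemma weight_ne_zero (ν : ℝ) {x : RSp d} (hx : x ≠ 0) : weight ν x ≠ 0 :=
  (mul_pos (exp_pos _) (rpow_pos_of_pos (norm_pos_iff.2 hx) _)).ne'

lemma measurable_inv_weight (ν : ℝ) : Measurable fun x : RSp d => (weight ν x)⁻¹ := by
  unfold weight
  fun_prop

variable [NeZero d]

lemma inv_weight_smul_weight_smul_ae_eq (ν : ℝ) (f : RSp d → CSp d) :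
    ((fun x : RSp d => (weight ν x)⁻¹) • fun x : RSp d => weight ν x • f x) =ᵐ[volume] f := by
  filter_upwards [Measure.ae_ne volume (0 : RSp d)] with x hx
  exact inv_smul_smul₀ (weight_ne_zero ν hx) (f x)

lemma MemWeighted.aemeasurable {p ν : ℝ} {f : RSp d → CSp d} (hf : MemWeighted p ν f) :
    AEMeasurable f :=
  ((measurable_inv_weight ν).aemeasurable.smul hf.1.aemeasurable).congr
    (inv_weight_smul_weight_smul_ae_eq ν f)

lemma memLp_inv_weight {q ν : ℝ} (hq : 0 < q) (hν : ν * q < d) :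
    MemLp (fun x : RSp d => (weight ν x)⁻¹) (ENNReal.ofReal q) := by
  rw [← integrable_norm_rpow_iff (measurable_inv_weight ν).aestronglyMeasurable (by simpa)
    ENNReal.ofReal_ne_top, ENNReal.toReal_ofReal hq.le]
  refine (integrable_fun_norm_addHaar (E := RSp d) volume
    (f := fun s : ℝ => ‖(exp s * s ^ ν)⁻¹‖ ^ q)).2 ?_
  rw [finrank_euclideanSpace_fin]
  refine (integrableOn_rpow_mul_exp_neg_mul_rpow (p := 1) (s := d - 1 - ν * q) (b := q)
    (by linarith) one_pos hq).congr_fun (fun s (hs : 0 < s) => ?_) measurableSet_Ioi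
  have hpow : s ^ ((d : ℝ) - 1 - ν * q) = s ^ (d - 1) * ((s ^ ν) ^ q)⁻¹ := by
    rw [rpow_sub hs, rpow_mul hs.le, ← rpow_natCast, Nat.cast_pred (NeZero.pos d), div_eq_mul_inv]
  have hexp : exp (-q * s) = (exp s ^ q)⁻¹ := by
    rw [← exp_mul, ← exp_neg, neg_mul, mul_comm]
  beta_reduce
  rw [smul_eq_mul, rpow_one, hpow, hexp, norm_of_nonneg (by positivity), inv_rpow (by positivity),
    mul_rpow (exp_nonneg _) (by positivity)]
  ring

lemma MemWeighted.lintegral_enorm_le {p q ν : ℝ} (hpq : p.HolderConjugate q) {f : RSp d → CSp d}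
    (hf : MemWeighted p ν f) :
    ∫⁻ x, ‖f x‖ₑ ≤
      eLpNorm (fun x : RSp d => (weight ν x)⁻¹) (ENNReal.ofReal q) volume * wNorm p ν f := by
  have := hpq.symm.ennrealOfReal
  rw [← eLpNorm_one_eq_lintegral_enorm,
    ← eLpNorm_congr_ae (inv_weight_smul_weight_smul_ae_eq ν f)]
  exact eLpNorm_smul_le_mul_eLpNorm hf.1 (measurable_inv_weight ν).aestronglyMeasurable

lemma exists_forall_lintegral_enorm_lt {p ν : ℝ} (hp : 1 < p) (hν : ν < d * ((p - 1) / p)) {ε : ℝ}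
    (hε : 0 < ε) :
    ∃ D : ℝ, 0 < D ∧ ∀ f : RSp d → CSp d, MemWeighted p ν f → wNorm p ν f < ENNReal.ofReal D →
      ∫⁻ x, ‖f x‖ₑ < ENNReal.ofReal ε := by
  have hpq := HolderConjugate.conjExponent hp
  have hνq : ν * p.conjExponent < d := by
    rwa [← lt_div_iff₀ hpq.symm.pos, hpq.conjugate_eq, div_div_eq_mul_div, mul_div_assoc]
  obtain ⟨D, hD, hlt⟩ := ENNReal.exists_nnreal_pos_mul_lt
    (memLp_inv_weight (d := d) hpq.symm.pos hνq).2.ne (ENNReal.ofReal_pos.2 hε).ne'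
  refine ⟨D, hD, fun f hf hfD => (hf.lintegral_enorm_le hpq).trans_lt (lt_of_le_of_lt ?_ hlt)⟩
  rw [ENNReal.ofReal_coe_nnreal] at hfD
  rw [mul_comm]
  gcongr

end Weight

section Exponents

variable {γ p ν κ r : ℝ}

lemma Admissible.lt_homogeneity [NeZero d] (h : Admissible d γ p ν κ r) :
    p < d * (r - p) / r + p * (ν + κ + 1) := by
  have hd : (0 : ℝ) < d := Nat.cast_pos.2 (NeZero.pos d)
  have hp : 0 < p := one_pos.trans h.one_lt_p
  have hr : 0 < r := one_pos.trans h.one_lt_r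
  have hscaling : d * (r - p) / r + p * (ν + κ + 1) = p + (d * (p - 1) - p * ν) := by
    rw [show d * (r - p) / r = d - d * p * (1 / r) by field_simp, h.scaling]
    field_simp
    ring
  have hν : p * ν < d * (p - 1) := by
    have := h.nu_lt
    rwa [← mul_div_assoc, lt_div_iff₀ hp, mul_comm] at this
  linarith

lemma Admissible.one_lt_gamma [NeZero d] (h : Admissible d γ p ν κ r) : 1 < γ := by
  have hp : 0 < p := one_pos.trans h.one_lt_p
  have hr : 0 < r := one_pos.trans h.one_lt_r
  have hr' : 0 < r - 1 := sub_pos.2 h.one_lt_r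
  have hX := h.lt_homogeneity
  have hassoc : γ * p * (r - 1) / r = γ * (p * (r - 1) / r) := by ring
  have hγ : 0 < γ := by
    have : 0 < γ * (p * (r - 1) / r) := hassoc ▸ (hp.trans hX).trans h.upper
    exact pos_of_mul_pos_left this (by positivity)
  have hle : γ * (p * (r - 1) / r) ≤ γ * p := by
    gcongr
    rw [div_le_iff₀ hr]
    gcongr
    linarith
  have hmul : 1 * p < γ * p := by linarith [h.gap]
  exact lt_of_mul_lt_mul_right hmul hp.le

end Exponents

end LerayBlowup

theorem mainTheorem6_general {d : ℕ} [NeZero d] {γ p ν : ℝ} (hγ : 1 < γ) (hp : 1 < p)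
    (hν : ν < d * ((p - 1) / p)) :
    ∃ D : ℝ, 0 < D ∧ ∀ (T : ℝ) (ϑ : LerayBlowup.RSp d → LerayBlowup.CSp d), 0 < T →
      LerayBlowup.MemWeighted p ν ϑ → LerayBlowup.wNorm p ν ϑ < ENNReal.ofReal D →
      LerayBlowup.SolvesNS γ T (LerayBlowup.selfSimilar γ T ϑ) → ϑ =ᵐ[volume] 0 := by
  have hβ : 0 < 1 - 1 / γ := sub_pos.2 ((div_lt_one (one_pos.trans hγ)).2 hγ)
  obtain ⟨D, hD, hsmall⟩ :=
    LerayBlowup.exists_forall_lintegral_enorm_lt hp hν (div_pos hβ four_pos)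
  exact ⟨D, hD, fun T ϑ hT hϑ hϑD hsol =>
    hsol.ae_eq_zero_of_lintegral_enorm_lt hγ hT hϑ.aemeasurable (hsmall ϑ hϑ hϑD)⟩

theorem mainTheorem6 (d : ℕ) (hd : 2 ≤ d) (γ p ν κ r : ℝ)
    (h : LerayBlowup.Admissible d γ p ν κ r) :
    ∃ D : ℝ, 0 < D ∧
      (∀ (T : ℝ) (ϑ : LerayBlowup.RSp d → LerayBlowup.CSp d), 0 < T →
        LerayBlowup.MemRadiallyDominated p ν ϑ →
        LerayBlowup.wNorm p ν ϑ < ENNReal.ofReal D →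
        LerayBlowup.SolvesNS γ T (LerayBlowup.selfSimilar γ T ϑ) →
        ϑ =ᵐ[MeasureTheory.volume] 0) ∧
      (∀ (T : ℝ) (ϑ : LerayBlowup.RSp d → LerayBlowup.CSp d), 0 < T →
        LerayBlowup.MemRadial p ν ϑ →
        LerayBlowup.wNorm p ν ϑ < ENNReal.ofReal D →
        LerayBlowup.SolvesNS γ T (LerayBlowup.selfSimilar γ T ϑ) →
        ϑ =ᵐ[MeasureTheory.volume] 0) := by
  have : NeZero d := ⟨by omega⟩
  obtain ⟨D, hD, hzero⟩ := mainTheorem6_general h.one_lt_gamma h.one_lt_p h.nu_lt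
  exact ⟨D, hD, fun T ϑ hT hϑ => hzero T ϑ hT hϑ.1, fun T ϑ hT hϑ => hzero T ϑ hT hϑ.1⟩
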